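/- A \emph{tree} is a partially ordered set $T$ in which the set $\{y\in T: y<x\}$ is well-ordered for every $x\in T$. The \emph{height} of $x$ is the order type of this set, the level $T_\alpha$ is the set of nodes of height $\alpha$, and the height of $T$ is the least $\alpha$ with $T_\alpha=\emptyset$. An \emph{$\aleph_1$-tree} is a tree of height $\omega_1$ all of whose levels $T_\alpha$ ($\alpha<\omega_1$) are countable. An $\aleph_1$-tree is \emph{Aronszajn} if no maximal chain meets all of its levels, \emph{Suslin} if it has neither uncountable chains nor uncountable antichains (an antichain being a set of pairwise incomparable nodes), and \emph{special} if it is a union of countably many antichains. A tree is \emph{infinitely splitting} if every node has infinitely many immediate successors. The \emph{fine wedge topology} on a tree $T$ is the topology generated by the cones $\{y\in T: t\le y\}$, $t\in T$, and their complements. A \emph{Lindelöf tree} is an $\aleph_1$-tree that is a Lindelöf space in its fine wedge topology. The principle $\diamondsuit$ asserts that there is a sequence $\langle A_\alpha:\alpha<\omega_1\rangle$ with $A_\alpha\subseteq\alpha$ such that for every $A\subseteq\omega_1$ the set $\{\alpha<\omega_1: A\cap\alpha=A_\alpha\}$ is stationary in $\omega_1$. \textbf{Theorem.} Assume $\diamondsuit$.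 Then: \begin{enumerate} \item There is a special Aronszajn tree that is Lindelöf in the fine wedge topology. \item There is a Lindelöf tree that is not Suslin. \item Among infinitely splitting trees, the Suslin trees form a strictly smaller class than the Lindelöf trees: every infinitely splitting Suslin tree is a Lindelöf tree, and there is an infinitely splitting Lindelöf tree that is not Suslin. \end{enumerate} -/

import Mathlib

universe u

open Set
open scoped Ordinal

/-- Jensen's diamond principle. The type `(ω₁ : Ordinal.{u}).ToType` is the well-ordered set of all
ordinals below `ω₁`, and `Set.Iio α`, the set of its elements below `α`, is the ordinal `α`. -/
def Diamond : Prop :=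
  ∃ A : (ω₁ : Ordinal.{u}).ToType → Set (ω₁ : Ordinal.{u}).ToType,
    (∀ α, A α ⊆ Iio α) ∧
      ∀ B : Set (ω₁ : Ordinal.{u}).ToType, IsStationary {α | B ∩ Iio α = A α}

/-- A partially ordered set is a tree if the predecessors of every point are well-ordered. -/
class IsTreeOrder (T : Type u) [PartialOrder T] : Prop where
  isWellOrder_Iio : ∀ x : T, IsWellOrder (Iio x) (· < ·)

attribute [instance] IsTreeOrder.isWellOrder_Iio

section Trees

variable (T : Type u) [PartialOrder T]

/-- The height of a node: the order type of the set of its predecessors. -/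
noncomputable def nodeHeight {T : Type u} [PartialOrder T] [IsTreeOrder T] (x : T) : Ordinal.{u} :=
  Ordinal.type (fun a b : Iio x => a < b)

/-- Level `α` of the tree. -/
def treeLevel [IsTreeOrder T] (α : Ordinal.{u}) : Set T :=
  {x | nodeHeight x = α}

/-- The height of the tree: the least `α` such that level `α` is empty. -/
noncomputable def treeHeight [IsTreeOrder T] : Ordinal.{u} :=
  sInf {α | treeLevel T α = ∅}

/-- An `ℵ₁`-tree: a tree of height `ω₁` all of whose levels are countable. -/
def IsAlephOneTree [IsTreeOrder T] : Prop :=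
  treeHeight T = ω₁ ∧ ∀ α < (ω₁ : Ordinal.{u}), (treeLevel T α).Countable

/-- A cofinal branch: a maximal chain that meets every level of the tree. -/
def IsCofinalBranch {T : Type u} [PartialOrder T] [IsTreeOrder T] (b : Set T) : Prop :=
  IsMaxChain (· ≤ ·) b ∧ ∀ α < treeHeight T, (b ∩ treeLevel T α).Nonempty

/-- An Aronszajn tree: an `ℵ₁`-tree without cofinal branches. -/
def IsAronszajnTree [IsTreeOrder T] : Prop :=
  IsAlephOneTree T ∧ ¬ ∃ b : Set T, IsCofinalBranch b

/-- A Suslin tree: an `ℵ₁`-tree without uncountable chains and without uncountable antichains. -/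
def IsSuslinTree [IsTreeOrder T] : Prop :=
  IsAlephOneTree T ∧
    (∀ C : Set T, IsChain (· ≤ ·) C → C.Countable) ∧
      ∀ A : Set T, IsAntichain (· ≤ ·) A → A.Countable

/-- A special tree: an `ℵ₁`-tree that is a countable union of antichains. -/
def IsSpecialTree [IsTreeOrder T] : Prop :=
  IsAlephOneTree T ∧
    ∃ A : ℕ → Set T, (∀ n, IsAntichain (· ≤ ·) (A n)) ∧ ⋃ n, A n = univ

/-- Every node has infinitely many immediate successors. -/
def IsInfinitelySplitting : Prop :=
  ∀ x : T, {y : T | x ⋖ y}.Infinite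

/-- The fine wedge topology, generated by the cones `{y | t ≤ y}` and their complements. -/
@[reducible] def fineWedgeTopology : TopologicalSpace T :=
  TopologicalSpace.generateFrom {U | ∃ t : T, U = Ici t ∨ U = (Ici t)ᶜ}

/-- A Lindelöf tree: an `ℵ₁`-tree that is a Lindelöf space in the fine wedge topology. -/
def IsLindelofTree [IsTreeOrder T] : Prop :=
  IsAlephOneTree T ∧ @LindelofSpace T (fineWedgeTopology T)

end Trees

/-! ### The Lindelöf property of the fine wedge topology -/

/-! A basic neighbourhood of `x` is its cone minus finitely many cones not containing `x`. An open
cover thus gives finite sets `F x` of nodes not below `x`, and countably many `x` must suffice for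
every `y` to lie above one of them while avoiding the cones of `F x` (`lindelofSpace_fineWedge`).

In an infinitely splitting Suslin tree, the nodes whose entire cone is covered by one such
neighbourhood are dense. A maximal antichain of them is countable, and only countably many nodes lie
below it.

The special tree consists of strictly increasing rational sequences; the last value makes it
special. Diamond guesses `F`, coded as a function on `ω₁ × ℕ`. A sequence may enter a limit level
`a` only if, for some `b < a`, its restrictions strictly between `b` and `a` avoid the finite set
guessed for its restriction to `b`. If the guess at `a` is correct, nodes of level at most `a` cover
the tree. Extensions survive because a finite set excludes only finitely many rational values at the
level just after `b`. -/

theorem exists_finset_of_isOpen_fineWedge {T : Type u} [PartialOrder T] {U : Set T}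
    (hU : @IsOpen T (fineWedgeTopology T) U) {x : T} (hx : x ∈ U) :
    ∃ F : Finset T, (∀ s ∈ F, ¬ s ≤ x) ∧ ∀ y, x ≤ y → (∀ s ∈ F, ¬ s ≤ y) → y ∈ U := by
  classical
  induction hU with
  | basic V hV =>
    obtain ⟨t, rfl | rfl⟩ := hV
    · exact ⟨∅, by simp, fun y hy _ => le_trans hx hy⟩
    · exact ⟨{t}, by simpa using hx, fun y _ h => by simpa using h⟩
  | univ => exact ⟨∅, by simp, fun _ _ _ => trivial⟩
  | inter V W _ _ ihV ihW =>
    obtain ⟨F, hF, hF'⟩ := ihV hx.1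
    obtain ⟨G, hG, hG'⟩ := ihW hx.2
    refine ⟨F ∪ G, fun s hs => ?_, fun y hy h => ⟨hF' y hy fun s hs => h s ?_,
      hG' y hy fun s hs => h s ?_⟩⟩
    · exact (Finset.mem_union.1 hs).elim (hF s) (hG s)
    · exact Finset.mem_union_left _ hs
    · exact Finset.mem_union_right _ hs
  | sUnion S _ ih =>
    obtain ⟨V, hV, hxV⟩ := hx
    obtain ⟨F, hF, hF'⟩ := ih V hV hxV
    exact ⟨F, hF, fun y hy h => ⟨V, hV, hF' y hy h⟩⟩

theorem lindelofSpace_fineWedge {T : Type u} [PartialOrder T]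
    (h : ∀ F : T → Finset T, (∀ x, ∀ s ∈ F x, ¬ s ≤ x) →
      ∃ C : Set T, C.Countable ∧ ∀ y, ∃ x ∈ C, x ≤ y ∧ ∀ s ∈ F x, ¬ s ≤ y) :
    @LindelofSpace T (fineWedgeTopology T) := by
  let _ := fineWedgeTopology T
  refine ⟨isLindelof_of_countable_subcover fun {ι} U hU hcov => ?_⟩
  have hx : ∀ x : T, ∃ i, x ∈ U i := fun x => mem_iUnion.1 (hcov (mem_univ x))
  choose i hi using hx
  choose F hF hF' using fun x => exists_finset_of_isOpen_fineWedge (hU (i x)) (hi x)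
  obtain ⟨C, hC, hcovC⟩ := h F hF
  refine ⟨i '' C, hC.image i, fun y _ => ?_⟩
  obtain ⟨x, hxC, hxy, hs⟩ := hcovC y
  exact mem_iUnion₂.2 ⟨i x, mem_image_of_mem i hxC, hF' x y hxy hs⟩

/-! ### Infinitely splitting Suslin trees -/

theorem IsTreeOrder.le_or_le {T : Type u} [PartialOrder T] [IsTreeOrder T] {x y z : T}
    (hx : x ≤ z) (hy : y ≤ z) : x ≤ y ∨ y ≤ x := by
  obtain rfl | hx := hx.eq_or_lt
  · exact Or.inr hy
  obtain rfl | hy := hy.eq_or_lt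
  · exact Or.inl hx.le
  by_contra! hcon
  have h : (⟨x, hx⟩ : Iio z) = ⟨y, hy⟩ :=
    (IsTreeOrder.isWellOrder_Iio z).toTrichotomous.trichotomous _ _
      (fun h => hcon.1 (le_of_lt h)) fun h => hcon.2 (le_of_lt h)
  exact hcon.1 (Subtype.ext_iff.1 h).le

/-- Distinct immediate successors of `x` are incomparable, so no node of `F` lies above two of them;
finitely many nodes cannot block infinitely many successors. -/
theorem exists_covBy_forall_not_le {T : Type u} [PartialOrder T] [IsTreeOrder T]
    (hT : IsInfinitelySplitting T) (x : T) (F : Finset T) :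
    ∃ y, x ⋖ y ∧ ∀ s ∈ F, ¬ y ≤ s := by
  by_contra! hcon
  choose! f hf hf' using hcon
  refine hT x (Finite.of_finite_image (f := f) (F.finite_toSet.subset ?_) ?_)
  · rintro _ ⟨y, hy, rfl⟩
    exact hf y hy
  · intro y hy z hz hyz
    have hy' := hf' y hy
    have hz' := hf' z hz
    rw [← hyz] at hz'
    obtain h | h := IsTreeOrder.le_or_le hy' hz'
    · exact (hz.eq_or_eq hy.le h).resolve_left hy.lt.ne'
    · exact ((hy.eq_or_eq hz.le h).resolve_left hz.lt.ne').symm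

theorem exists_ge_forall_not_le {T : Type u} [PartialOrder T] [IsTreeOrder T]
    (hT : IsInfinitelySplitting T) (x : T) (F : Finset T) (hF : ∀ s ∈ F, ¬ s ≤ x) :
    ∃ y, x ≤ y ∧ ∀ z, y ≤ z → ∀ s ∈ F, ¬ s ≤ z := by
  obtain ⟨y, hxy, hy⟩ := exists_covBy_forall_not_le hT x F
  refine ⟨y, hxy.le, fun z hyz s hs hsz => ?_⟩
  obtain h | h := IsTreeOrder.le_or_le hsz hyz
  · obtain h' | h' := IsTreeOrder.le_or_le h hxy.le
    · exact hF s hs h'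
    · obtain rfl | rfl := hxy.eq_or_eq h' h
      · exact hF _ hs le_rfl
      · exact hy _ hs le_rfl
  · exact hy s hs h

theorem IsSuslinTree.isLindelofTree {T : Type u} [PartialOrder T] [IsTreeOrder T]
    (hT : IsInfinitelySplitting T) (hS : IsSuslinTree T) : IsLindelofTree T := by
  refine ⟨hS.1, lindelofSpace_fineWedge fun F hF => ?_⟩
  -- These are the nodes whose whole cone lies in the neighbourhood of a single `x`; by
  -- `exists_ge_forall_not_le` they are dense.
  set D : Set T := {y | ∃ x ≤ y, ∀ z, y ≤ z → ∀ s ∈ F x, ¬ s ≤ z}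
  obtain ⟨A, hA⟩ : ∃ A : Set T, Maximal (fun A => A ⊆ D ∧ IsAntichain (· ≤ ·) A) A := by
    obtain ⟨A, -, hA⟩ := zorn_subset_nonempty {A : Set T | A ⊆ D ∧ IsAntichain (· ≤ ·) A}
      (fun c hc hchain _ => ⟨⋃₀ c, ⟨sUnion_subset fun s hs => (hc hs).1,
        (pairwise_sUnion hchain.directedOn).2 fun s hs => (hc hs).2⟩,
        fun s hs => subset_sUnion_of_mem hs⟩) ∅ ⟨empty_subset _, IsAntichain.empty⟩
    exact ⟨A, hA⟩
  have hcomp : ∀ y ∈ D, ∃ a ∈ A, a ≤ y ∨ y ≤ a := by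
    intro y hy
    by_contra! hcon
    have hins : insert y A ⊆ D ∧ IsAntichain (· ≤ ·) (insert y A) :=
      ⟨insert_subset hy hA.prop.1, hA.prop.2.insert
        (fun b hb _ => (hcon b hb).1) (fun b hb _ => (hcon b hb).2)⟩
    exact (hcon y (hA.le_of_ge hins (subset_insert y A) (mem_insert y A))).1 le_rfl
  choose! r hr hr' using fun y (hy : y ∈ D) => hy
  -- Nodes above some `a ∈ A` are covered by `r a`; nodes below some `a` cover themselves, and `Iic
  -- a` is a chain, hence countable.
  refine ⟨r '' A ∪ ⋃ a ∈ A, Iic a, ?_, fun y => ?_⟩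
  · refine ((hS.2.2 A hA.prop.2).image r).union ((hS.2.2 A hA.prop.2).biUnion fun a _ => hS.2.1 _ ?_)
    exact fun x hx y hy _ => IsTreeOrder.le_or_le hx hy
  · obtain ⟨z, hyz, hz⟩ := exists_ge_forall_not_le hT y (F y) (hF y)
    obtain ⟨a, ha, haz⟩ := hcomp z ⟨y, hyz, hz⟩
    have : a ≤ y ∨ y ≤ a := haz.elim (fun h => IsTreeOrder.le_or_le h hyz)
      fun h => Or.inr (hyz.trans h)
    obtain h | h := this
    · exact ⟨r a, Or.inl ⟨a, ha, rfl⟩, (hr a (hA.prop.1 ha)).trans h, hr' a (hA.prop.1 ha) y h⟩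
    · exact ⟨y, Or.inr (mem_iUnion₂.2 ⟨a, ha, h⟩), le_rfl, hF y⟩

/-! ### The well-ordered set of countable ordinals -/

/-- The well-ordered set of all countable ordinals. -/
abbrev OmegaOne : Type u := (ω₁ : Ordinal.{u}).ToType

namespace OmegaOne

theorem countable_Iio (a : OmegaOne.{u}) : (Iio a).Countable := by
  have h := Ordinal.typein_lt_self a
  replace h := Cardinal.lt_ord.1 (h.trans_eq (Cardinal.ord_aleph 1).symm)
  rw [← Ordinal.type_Iio_lt, Ordinal.card_type] at h
  rwa [← Cardinal.le_aleph0_iff_set_countable, ← Order.lt_succ_iff, Cardinal.succ_aleph0]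

theorem countable_Iic (a : OmegaOne.{u}) : (Iic a).Countable := by
  rw [← Iio_union_right]
  exact (countable_Iio a).union (countable_singleton a)

theorem mk_eq : Cardinal.mk OmegaOne.{u} = Cardinal.aleph 1 := by
  rw [Cardinal.mk_toType, Ordinal.card_omega]

instance : Uncountable OmegaOne.{u} := by
  rw [← Cardinal.aleph0_lt_mk_iff, mk_eq]
  exact Cardinal.aleph0_lt_aleph_one

theorem exists_forall_lt {S : Set OmegaOne.{u}} (hS : S.Countable) : ∃ a, ∀ s ∈ S, s < a := by
  by_contra! hcon
  have h : (⋃ s ∈ S, Iic s) = univ := eq_univ_of_forall fun a => by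
    obtain ⟨s, hs, h⟩ := hcon a
    exact mem_iUnion₂.2 ⟨s, hs, h⟩
  exact not_countable_univ (h ▸ hS.biUnion fun s _ => countable_Iic s)

instance : NoMaxOrder OmegaOne.{u} :=
  ⟨fun a => by simpa using exists_forall_lt (countable_singleton a)⟩

theorem isClub_closurePoints (g : OmegaOne.{u} → OmegaOne.{u}) :
    IsClub {a | (∃ b, b < a) ∧ ∀ b < a, g b < a} := by
  constructor
  · intro d hd hne _ a ha
    obtain ⟨c, hc⟩ := hne
    obtain ⟨⟨b, hb⟩, -⟩ := hd hc
    refine ⟨⟨b, hb.trans_le (ha.1 hc)⟩, fun b hb => ?_⟩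
    obtain ⟨e, he, hbe⟩ := (lt_isLUB_iff ha).1 hb
    exact ((hd he).2 b hbe).trans_le (ha.1 he)
  · intro a
    -- `n c` lies above `c` and above all values of `g` on `Iic c`, so the supremum of its iterates
    -- is closed under `g`.
    choose n hn using fun c : OmegaOne.{u} =>
      exists_forall_lt (((countable_Iic c).image g).union (countable_singleton c))
    let s : ℕ → OmegaOne.{u} := fun k => n^[k + 1] a
    have hs : ∀ k, s (k + 1) = n (s k) := fun k => Function.iterate_succ_apply' n (k + 1) a
    obtain ⟨ub, hub⟩ := exists_forall_lt (countable_range s)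
    obtain ⟨l, hl⟩ : ∃ l, IsLUB (range s) l := by
      have hne : (upperBounds (range s)).Nonempty := ⟨ub, fun x hx => (hub x hx).le⟩
      exact ⟨wellFounded_lt.min _ hne, wellFounded_lt.min_mem _ hne,
        fun x hx => not_lt.1 (wellFounded_lt.not_lt_min _ hx)⟩
    have ha : a < l := (hn a a (Or.inr rfl)).trans_le (hl.1 ⟨0, rfl⟩)
    refine ⟨l, ⟨⟨a, ha⟩, fun b hb => ?_⟩, ha.le⟩
    obtain ⟨_, ⟨k, rfl⟩, hk⟩ := (lt_isLUB_iff hl).1 hb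
    refine (hn (s k) (g b) (Or.inl ⟨b, hk.le, rfl⟩)).trans_le ?_
    rw [← hs]
    exact hl.1 ⟨k + 1, rfl⟩

end OmegaOne

/-- The consequence of diamond for finite-set-valued functions on `ω₁ × ℕ`. -/
theorem Diamond.exists_guess (h : Diamond.{u}) :
    ∃ G : OmegaOne.{u} → OmegaOne.{u} × ℕ → Finset (OmegaOne.{u} × ℕ),
      ∀ R : OmegaOne.{u} × ℕ → Finset (OmegaOne.{u} × ℕ), ∃ a : OmegaOne.{u},
        Order.IsSuccLimit a ∧ ∀ p : OmegaOne.{u} × ℕ, p.1 < a →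
          G a p = R p ∧ ∀ q ∈ R p, q.1 < a := by
  classical
  obtain ⟨A, -, hA⟩ := h
  -- Through `e` the graph of `R` becomes a subset of `ω₁`, which diamond can guess.
  obtain ⟨e⟩ : Nonempty ((OmegaOne.{u} × ℕ) × (OmegaOne.{u} × ℕ) ≃ OmegaOne.{u}) := by
    rw [← Cardinal.eq]
    have h1 : Cardinal.mk (OmegaOne.{u} × ℕ) = Cardinal.aleph 1 := by
      rw [Cardinal.mk_prod, Cardinal.lift_id', OmegaOne.mk_eq]
      simp [Cardinal.aleph0_le_aleph]
    rw [Cardinal.mk_prod, h1]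
    simp
  refine ⟨fun a p => if hf : {q | e (p, q) ∈ A a}.Finite then hf.toFinset else ∅, fun R => ?_⟩
  -- At closure points of `g` the values of `R` and the codes of its graph stay below `a`; including
  -- `b` itself makes these points limits.
  choose g hg using fun b : OmegaOne.{u} => OmegaOne.exists_forall_lt
    (S := (⋃ n : ℕ, ⋃ q ∈ R (b, n), {q.1, e ((b, n), q)}) ∪ {b})
    ((countable_iUnion fun n => (R (b, n)).countable_toSet.biUnion
      fun q _ => (Set.toFinite _).countable).union (countable_singleton b))
  obtain ⟨a, ha, hne, hcl⟩ := hA {x | ∃ p, ∃ q ∈ R p, e (p, q) = x} (OmegaOne.isClub_closurePoints g)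
  have hcl' : ∀ p : OmegaOne.{u} × ℕ, p.1 < a → ∀ q ∈ R p, q.1 < a ∧ e (p, q) < a := by
    rintro ⟨b, n⟩ hp q hq
    have := fun x hx => (hg b x (Or.inl (mem_iUnion.2 ⟨n, mem_iUnion₂.2 ⟨q, hq, hx⟩⟩))).trans (hcl b hp)
    exact ⟨this _ (Or.inl rfl), this _ (Or.inr rfl)⟩
  refine ⟨a, ⟨fun hmin => ?_, fun b hb => ?_⟩, fun p hp => ⟨?_, fun q hq => (hcl' p hp q hq).1⟩⟩
  · obtain ⟨b, hb⟩ := hne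
    exact hmin.not_lt hb
  · exact hb.2 (hg b b (Or.inr rfl)) (hcl b hb.lt)
  · have hR : {q | e (p, q) ∈ A a} = R p := by
      ext q
      rw [mem_ofPred_eq, ← show _ = A a from ha]
      constructor
      · rintro ⟨⟨p', q', hq', he⟩, -⟩
        obtain ⟨rfl, rfl⟩ := Prod.ext_iff.1 (e.injective he)
        exact hq'
      · exact fun hq => ⟨⟨p, q, hq, rfl⟩, (hcl' p hp q hq).2⟩
    have hfin : {q | e (p, q) ∈ A a}.Finite := hR ▸ (R p).finite_toSet
    simp only [dif_pos hfin]
    ext q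
    rw [Finite.mem_toFinset, hR, Finset.mem_coe]

/-! ### The levels of a sealed special tree of increasing sequences of rationals -/

/-- The restriction of a sequence to `Iic a`, extended by zero. -/
noncomputable def truncate (a : OmegaOne.{u}) (t : OmegaOne.{u} → ℚ) : OmegaOne.{u} → ℚ :=
  fun d => if d ≤ a then t d else 0

theorem truncate_apply {a d : OmegaOne.{u}} (h : d ≤ a) (t : OmegaOne.{u} → ℚ) :
    truncate a t d = t d :=
  if_pos h

theorem truncate_congr {a : OmegaOne.{u}} {s t : OmegaOne.{u} → ℚ} (h : EqOn s t (Iic a)) :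
    truncate a s = truncate a t := by
  funext d
  by_cases hd : d ≤ a
  · simp only [truncate, if_pos hd, h hd]
  · simp only [truncate, if_neg hd]

theorem truncate_eq_self {a : OmegaOne.{u}} {t : OmegaOne.{u} → ℚ} (h : ∀ d, a < d → t d = 0) :
    truncate a t = t := by
  funext d
  by_cases hd : d ≤ a
  · simp only [truncate, if_pos hd]
  · simp only [truncate, if_neg hd, h d (not_le.1 hd)]

theorem truncate_truncate {a b : OmegaOne.{u}} (h : b ≤ a) (t : OmegaOne.{u} → ℚ) :
    truncate b (truncate a t) = truncate b t :=
  truncate_congr fun _ hd => truncate_apply (le_trans hd h) t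

/-- A function to `ℕ` that is injective on the given set, if there is one. -/
noncomputable def code {X : Type u} (S : Set X) : X → ℕ :=
  Classical.epsilon fun f => InjOn f S

theorem injOn_code {X : Type u} {S : Set X} (hS : S.Countable) : InjOn (code S) S :=
  Classical.epsilon_spec (p := fun f : X → ℕ => InjOn f S) (countable_iff_exists_injOn.1 hS)

/-- The sequences that may be put on level `a` when the levels below `a` are given by `L`:
increasing sequences whose proper restrictions are on the lower levels, and which, at limit levels,
avoid from some point `b` on the finite set that `G a` assigns to their restriction to `b`. -/
structure IsNode (G : OmegaOne.{u} → OmegaOne.{u} × ℕ → Finset (OmegaOne.{u} × ℕ))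
    (L : OmegaOne.{u} → Set (OmegaOne.{u} → ℚ)) (a : OmegaOne.{u}) (t : OmegaOne.{u} → ℚ) :
    Prop where
  eq_zero : ∀ d, a < d → t d = 0
  strictMonoOn : StrictMonoOn t (Iic a)
  truncate_mem : ∀ b < a, truncate b t ∈ L b
  exists_avoid : Order.IsSuccLimit a → ∃ b < a, ∀ d, b < d → d < a →
    (d, code (L d) (truncate d t)) ∉ G a (b, code (L b) (truncate b t))

/-- The sequences put on level `a`: for each node `s` of a lower level and each rational `q` above
the last value of `s`, one extension of `s` with last value `q`. -/
def levelStep (G : OmegaOne.{u} → OmegaOne.{u} × ℕ → Finset (OmegaOne.{u} × ℕ))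
    (L : OmegaOne.{u} → Set (OmegaOne.{u} → ℚ)) (a : OmegaOne.{u}) : Set (OmegaOne.{u} → ℚ) :=
  {t | IsNode G L a t ∧ (IsMin a ∨ ∃ b < a, ∃ s ∈ L b, ∃ q : ℚ, t = Classical.epsilon fun t =>
    IsNode G L a t ∧ EqOn t s (Iic b) ∧ t a = q)}

theorem IsNode.congr {G : OmegaOne.{u} → OmegaOne.{u} × ℕ → Finset (OmegaOne.{u} × ℕ)}
    {L M : OmegaOne.{u} → Set (OmegaOne.{u} → ℚ)} {a : OmegaOne.{u}} (h : EqOn L M (Iio a))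
    {t : OmegaOne.{u} → ℚ} (ht : IsNode G L a t) : IsNode G M a t where
  eq_zero := ht.eq_zero
  strictMonoOn := ht.strictMonoOn
  truncate_mem b hb := h hb ▸ ht.truncate_mem b hb
  exists_avoid ha := by
    obtain ⟨b, hb, hb'⟩ := ht.exists_avoid ha
    exact ⟨b, hb, fun d hbd hda => h hb ▸ h hda ▸ hb' d hbd hda⟩

theorem levelStep_congr {G : OmegaOne.{u} → OmegaOne.{u} × ℕ → Finset (OmegaOne.{u} × ℕ)}
    {L M : OmegaOne.{u} → Set (OmegaOne.{u} → ℚ)} {a : OmegaOne.{u}} (h : EqOn L M (Iio a)) :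
    levelStep G L a = levelStep G M a := by
  have hiff : ∀ t, IsNode G L a t ↔ IsNode G M a t := fun t =>
    ⟨fun ht => ht.congr h, fun ht => ht.congr h.symm⟩
  ext t
  simp only [levelStep, mem_ofPred_eq, hiff]
  refine and_congr_right fun _ => or_congr_right (exists_congr fun b => and_congr_right fun hb => ?_)
  rw [h hb]

theorem exists_eq_levelStep (G : OmegaOne.{u} → OmegaOne.{u} × ℕ → Finset (OmegaOne.{u} × ℕ)) :
    ∃ L : OmegaOne.{u} → Set (OmegaOne.{u} → ℚ), ∀ a, L a = levelStep G L a := by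
  classical
  let F (a : OmegaOne.{u}) (L : ∀ b, b < a → Set (OmegaOne.{u} → ℚ)) : Set (OmegaOne.{u} → ℚ) :=
    levelStep G (fun b => if h : b < a then L b h else ∅) a
  refine ⟨(wellFounded_lt (α := OmegaOne.{u})).fix F, fun a => ?_⟩
  rw [WellFounded.fix_eq]
  exact levelStep_congr fun b hb => dif_pos hb

section Levels

variable {G : OmegaOne.{u} → OmegaOne.{u} × ℕ → Finset (OmegaOne.{u} × ℕ)}
  {L : OmegaOne.{u} → Set (OmegaOne.{u} → ℚ)}

theorem isNode_of_mem (hL : ∀ a, L a = levelStep G L a) {a : OmegaOne.{u}}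
    {t : OmegaOne.{u} → ℚ} (ht : t ∈ L a) : IsNode G L a t := by
  rw [hL] at ht
  exact ht.1

theorem truncate_self_of_mem (hL : ∀ a, L a = levelStep G L a) {a : OmegaOne.{u}}
    {t : OmegaOne.{u} → ℚ} (ht : t ∈ L a) : truncate a t = t :=
  truncate_eq_self (isNode_of_mem hL ht).eq_zero

theorem truncate_mem (hL : ∀ a, L a = levelStep G L a) {a b : OmegaOne.{u}} (hab : b ≤ a)
    {t : OmegaOne.{u} → ℚ} (ht : t ∈ L a) : truncate b t ∈ L b := by
  obtain rfl | h := hab.eq_or_lt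
  · rwa [truncate_self_of_mem hL ht]
  · exact (isNode_of_mem hL ht).truncate_mem b h

/-- Any node extends to level `a` with any larger last value. -/
def HasExtensions (L : OmegaOne.{u} → Set (OmegaOne.{u} → ℚ)) (a : OmegaOne.{u}) : Prop :=
  ∀ b < a, ∀ s ∈ L b, ∀ q, s b < q → ∃ t ∈ L a, EqOn t s (Iic b) ∧ t a = q

theorem HasExtensions.exists_lt {a b : OmegaOne.{u}} (h : HasExtensions L a) (hb : b ≤ a)
    {s : OmegaOne.{u} → ℚ} (hs : s ∈ L b) {q : ℚ} (hq : s b < q) :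
    ∃ t ∈ L a, EqOn t s (Iic b) ∧ t a < q := by
  obtain rfl | hb := hb.eq_or_lt
  · exact ⟨s, hs, fun _ _ => rfl, hq⟩
  · obtain ⟨r, hr, hrq⟩ := exists_between hq
    obtain ⟨t, ht, hts, hta⟩ := h b hb s hs r hr
    exact ⟨t, ht, hts, hta ▸ hrq⟩

/-- The part of the definition of a node at a limit level that does not involve avoidance. -/
theorem exists_limit_sequence (hL : ∀ a, L a = levelStep G L a) {a : OmegaOne.{u}}
    (hext : ∀ c < a, HasExtensions L c) {b : OmegaOne.{u}} (hb : b < a) {s : OmegaOne.{u} → ℚ}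
    (hs : s ∈ L b) {q : ℚ} (hq : s b < q) :
    ∃ t : OmegaOne.{u} → ℚ, (∀ d, a < d → t d = 0) ∧ StrictMonoOn t (Iic a) ∧
      (∀ c < a, truncate c t ∈ L c) ∧ EqOn t s (Iic b) ∧ t a = q := by
  classical
  obtain ⟨e, he⟩ := (OmegaOne.countable_Iio a).exists_eq_range ⟨b, hb⟩
  -- Approximations keep their last value below `q`, leaving room for `q` at level `a`. Their levels
  -- eventually pass every `e n`, so they exhaust `a`.
  let X := {p : OmegaOne.{u} × (OmegaOne.{u} → ℚ) // p.1 < a ∧ p.2 ∈ L p.1 ∧ p.2 p.1 < q}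
  have hstep : ∀ (n : ℕ) (p : X), ∃ p' : X, p.1.1 ≤ p'.1.1 ∧ e n ≤ p'.1.1 ∧
      EqOn p'.1.2 p.1.2 (Iic p.1.1) := by
    rintro n ⟨⟨c, r⟩, hc, hr, hrq⟩
    have hen : e n < a := he.symm.subset ⟨n, rfl⟩
    obtain ⟨t, ht, htr, htq⟩ :=
      (hext (max c (e n)) (max_lt hc hen)).exists_lt (le_max_left c (e n)) hr hrq
    exact ⟨⟨(max c (e n), t), max_lt hc hen, ht, htq⟩, le_max_left _ _, le_max_right _ _, htr⟩
  choose f hf1 hf2 hf3 using hstep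
  let x : ℕ → X := fun n => Nat.rec ⟨(b, s), hb, hs, hq⟩ f n
  have hmono : Monotone fun n => (x n).1.1 := monotone_nat_of_le_succ fun n => hf1 n (x n)
  have heq : ∀ m n, m ≤ n → EqOn (x n).1.2 (x m).1.2 (Iic (x m).1.1) := by
    intro m n hmn
    induction n, hmn using Nat.le_induction with
    | base => exact fun _ _ => rfl
    | succ n hmn ih =>
      exact fun d hd => (hf3 n (x n) (le_trans hd (hmono hmn))).trans (ih hd)
  have hk : ∀ d, d < a → ∃ n, d ≤ (x n).1.1 := by
    intro d hd
    obtain ⟨n, rfl⟩ := he.subset hd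
    exact ⟨n + 1, hf2 n (x n)⟩
  choose! k hk using hk
  let t : OmegaOne.{u} → ℚ := fun d => if d < a then (x (k d)).1.2 d else if d = a then q else 0
  have ht : ∀ n d, d ≤ (x n).1.1 → t d = (x n).1.2 d := by
    intro n d hd
    have hda : d < a := hd.trans_lt (x n).2.1
    simp only [t, if_pos hda]
    obtain h | h := le_total (k d) n
    · exact (heq _ _ h (hk d hda)).symm
    · exact heq _ _ h hd
  have hta : t a = q := by simp [t]
  refine ⟨t, fun d hd => by simp [t, hd.not_gt, hd.ne'], ?_, fun c hc => ?_, ht 0, hta⟩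
  · intro d hd d' hd' hlt
    obtain rfl | hda' := (mem_Iic.1 hd').eq_or_lt
    · rw [hta, ht (k d) d (hk d hlt)]
      exact ((isNode_of_mem hL (x (k d)).2.2.1).strictMonoOn.monotoneOn (hk d hlt) self_mem_Iic
        (hk d hlt)).trans_lt (x (k d)).2.2.2
    · have h := hk d' hda'
      rw [ht _ d' h, ht _ d (hlt.le.trans h)]
      exact (isNode_of_mem hL (x (k d')).2.2.1).strictMonoOn (hlt.le.trans h) h hlt
  · rw [truncate_congr fun d hd => ht (k c) d (le_trans hd (hk c hc))]
    exact truncate_mem hL (hk c hc) (x (k c)).2.2.1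

/-- Extend `s` to level `c` with last value below `q`, then append `q`; avoidance is only required
at limits. -/
theorem exists_isNode_of_covBy (hL : ∀ a, L a = levelStep G L a) {a c : OmegaOne.{u}}
    (hca : c ⋖ a) (hext : HasExtensions L c) {b : OmegaOne.{u}} (hb : b < a)
    {s : OmegaOne.{u} → ℚ} (hs : s ∈ L b) {q : ℚ} (hq : s b < q) :
    ∃ t, IsNode G L a t ∧ EqOn t s (Iic b) ∧ t a = q := by
  classical
  obtain ⟨r, hr, hrs, hrq⟩ := hext.exists_lt (hca.le_of_lt hb) hs hq
  have hne : ∀ {d}, d < a → Function.update r a q d = r d :=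
    fun hd => Function.update_of_ne hd.ne _ _
  have hrn := isNode_of_mem hL hr
  refine ⟨Function.update r a q, ⟨fun d hd => ?_, fun d hd d' hd' hlt => ?_, fun d hd => ?_,
    fun hlim => (hlim.isSuccPrelimit c hca).elim⟩, fun d hd => ?_, Function.update_self _ _ _⟩
  · rw [Function.update_of_ne hd.ne', hrn.eq_zero d (hca.lt.trans hd)]
  · have hdc := hca.le_of_lt (hlt.trans_le hd')
    rw [hne (hlt.trans_le hd')]
    obtain rfl | hda' := (mem_Iic.1 hd').eq_or_lt
    · rw [Function.update_self]
      exact (hrn.strictMonoOn.monotoneOn hdc self_mem_Iic hdc).trans_lt hrq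
    · rw [hne hda']
      exact hrn.strictMonoOn hdc (hca.le_of_lt hda') hlt
  · rw [truncate_congr fun d' hd' => hne (lt_of_le_of_lt hd' hd)]
    exact truncate_mem hL (hca.le_of_lt hd) hr
  · rw [hne (lt_of_le_of_lt hd hb), hrs hd]

theorem exists_isNode_of_isSuccLimit (hL : ∀ a, L a = levelStep G L a) {a : OmegaOne.{u}}
    (ha : Order.IsSuccLimit a) (hext : ∀ c < a, (L c).Countable ∧ HasExtensions L c)
    {b : OmegaOne.{u}} (hb : b < a) {s : OmegaOne.{u} → ℚ} (hs : s ∈ L b) {q : ℚ} (hq : s b < q) :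
    ∃ t, IsNode G L a t ∧ EqOn t s (Iic b) ∧ t a = q := by
  have hsucc : Order.succ b < a := ha.succ_lt hb
  -- Codes are injective on countable levels, so each guessed pair names at most one node and rules
  -- out at most one value at `Order.succ b`.
  have hbad : (⋃ p ∈ G a (b, code (L b) s), {r : ℚ | p.1 < a ∧ ∃ t ∈ L p.1, code (L p.1) t = p.2 ∧
      t (Order.succ b) = r}).Finite := by
    refine (G a (b, code (L b) s)).finite_toSet.biUnion fun p _ => Set.Subsingleton.finite ?_
    rintro r ⟨hp, t, ht, htp, rfl⟩ r' ⟨-, t', ht', htp', rfl⟩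
    rw [injOn_code (hext p.1 hp).1 ht ht' (htp.trans htp'.symm)]
  obtain ⟨r, ⟨hr, hrq⟩, hrbad⟩ := (Ioo_infinite hq).exists_notMem_finite hbad
  obtain ⟨s', hs', hs's, hs'r⟩ := (hext _ hsucc).2 b (Order.lt_succ b) s hs r hr
  obtain ⟨t, ht0, htmono, htmem, hts', hta⟩ := exists_limit_sequence hL (fun c hc => (hext c hc).2)
    hsucc hs' (hs'r.trans_lt hrq)
  have hts : EqOn t s (Iic b) := fun d hd =>
    (hts' (le_trans hd (Order.le_succ b))).trans (hs's hd)
  -- A guessed restriction of `t` beyond `b` would have the value `r` at `Order.succ b`, and `r` was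
  -- chosen outside the bad set.
  refine ⟨t, ⟨ht0, htmono, htmem, fun _ => ⟨b, hb, fun d hbd hda hd => hrbad ?_⟩⟩, hts, hta⟩
  rw [truncate_congr hts, truncate_self_of_mem hL hs] at hd
  refine mem_iUnion₂.2 ⟨_, hd, hda, _, htmem d hda, rfl, ?_⟩
  rw [truncate_apply (Order.succ_le_of_lt hbd), hts' self_mem_Iic, hs'r]

/-- A node on the bottom level is determined by its single value; any other is the one extension
chosen for some triple `(b, s, q)`. -/
theorem countable_level (hL : ∀ a, L a = levelStep G L a) {a : OmegaOne.{u}}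
    (h : ∀ b < a, (L b).Countable) : (L a).Countable := by
  by_cases ha : IsMin a
  · refine MapsTo.countable_of_injOn (f := fun t => t a) (t := univ) (fun _ _ => mem_univ _) ?_
      countable_univ
    intro s hs t ht hst
    rw [← truncate_self_of_mem hL hs, ← truncate_self_of_mem hL ht]
    refine truncate_congr fun d hd => ?_
    rw [le_antisymm hd (ha hd)]
    exact hst
  · rw [hL]
    have hcount : (⋃ b ∈ Iio a, ⋃ s ∈ L b, range fun q : ℚ => Classical.epsilon fun t =>
        IsNode G L a t ∧ EqOn t s (Iic b) ∧ t a = q).Countable :=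
      (OmegaOne.countable_Iio a).biUnion fun b hb => (h b hb).biUnion fun s _ => countable_range _
    refine hcount.mono ?_
    rintro t ⟨-, ht⟩
    obtain ⟨b, hb, s, hs, q, rfl⟩ := ht.resolve_left ha
    exact mem_iUnion₂.2 ⟨b, hb, mem_iUnion₂.2 ⟨s, hs, q, rfl⟩⟩

/-- The two properties need a joint induction: extending to a limit level uses injective codes,
hence countability, on lower levels. -/
theorem countable_and_hasExtensions (hL : ∀ a, L a = levelStep G L a) (a : OmegaOne.{u}) :
    (L a).Countable ∧ HasExtensions L a := by
  induction a using WellFoundedLT.induction with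
  | ind a ih =>
  refine ⟨countable_level hL fun b hb => (ih b hb).1, fun b hb s hs q hq => ?_⟩
  have hex : ∃ t, IsNode G L a t ∧ EqOn t s (Iic b) ∧ t a = q := by
    by_cases ha : Order.IsSuccLimit a
    · exact exists_isNode_of_isSuccLimit hL ha ih hb hs hq
    · have : ¬ Order.IsSuccPrelimit a := fun h => ha ⟨fun hmin => hmin.not_lt hb, h⟩
      obtain ⟨c, hc⟩ := Order.not_isSuccPrelimit_iff.1 this
      exact exists_isNode_of_covBy hL hc (ih c hc.lt).2 hb hs hq
  have hspec := Classical.epsilon_spec hex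
  refine ⟨_, ?_, hspec.2⟩
  rw [hL]
  exact ⟨hspec.1, Or.inr ⟨b, hb, s, hs, q, rfl⟩⟩

theorem nonempty_level (hL : ∀ a, L a = levelStep G L a) (a : OmegaOne.{u}) : (L a).Nonempty := by
  have hzero : ∀ a, IsMin a → (0 : OmegaOne.{u} → ℚ) ∈ L a := by
    intro a ha
    rw [hL]
    refine ⟨⟨fun _ _ => rfl, fun b hb c hc hbc => ?_, fun b hb => (ha.not_lt hb).elim,
      fun hlim => (hlim.not_isMin ha).elim⟩, Or.inl ha⟩
    exact (ha.not_lt (hbc.trans_le hc)).elim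
  by_cases ha : IsMin a
  · exact ⟨0, hzero a ha⟩
  · obtain ⟨m, hm⟩ : ∃ m : OmegaOne.{u}, IsMin m :=
      ⟨wellFounded_lt.min univ ⟨a, mem_univ a⟩, fun b _ => not_lt.1 (wellFounded_lt.not_lt_min _ (mem_univ b))⟩
    have hma : m < a := lt_of_not_ge fun h => ha fun b hb => h.trans (hm.isBot b)
    obtain ⟨t, ht, -⟩ := (countable_and_hasExtensions hL a).2 m hma 0 (hzero m hm) 1 zero_lt_one
    exact ⟨t, ht⟩

end Levels

/-! ### The tree -/

section LevelTree

variable (G : OmegaOne.{u} → OmegaOne.{u} × ℕ → Finset (OmegaOne.{u} × ℕ))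

/-- The levels of the tree that avoids the guesses `G`. -/
noncomputable def level : OmegaOne.{u} → Set (OmegaOne.{u} → ℚ) :=
  Classical.choose (exists_eq_levelStep G)

theorem level_eq (a : OmegaOne.{u}) : level G a = levelStep G (level G) a :=
  Classical.choose_spec (exists_eq_levelStep G) a

/-- The tree of all sequences in the levels that avoid the guesses `G`, ordered by extension. -/
@[ext] structure LevelTree : Type u where
  /-- The level of a node. -/
  lev : OmegaOne.{u}
  /-- The sequence of a node, extended by zero. -/
  seq : OmegaOne.{u} → ℚ
  seq_mem : seq ∈ level G lev

namespace LevelTree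

variable {G}

instance : PartialOrder (LevelTree G) where
  le x y := x.lev ≤ y.lev ∧ truncate x.lev y.seq = x.seq
  le_refl x := ⟨le_rfl, truncate_self_of_mem (level_eq G) x.seq_mem⟩
  le_trans x y z hxy hyz := ⟨hxy.1.trans hyz.1, by
    rw [← hxy.2, ← hyz.2, truncate_truncate hxy.1]⟩
  le_antisymm x y hxy hyx := by
    have h := hxy.1.antisymm hyx.1
    refine LevelTree.ext h ?_
    rw [← hxy.2, h, truncate_self_of_mem (level_eq G) y.seq_mem]

theorem eq_of_le_of_lev_le {x y : LevelTree G} (h : x ≤ y) (h' : y.lev ≤ x.lev) : x = y := by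
  have hlev := h.1.antisymm h'
  refine LevelTree.ext hlev ?_
  rw [← h.2, hlev, truncate_self_of_mem (level_eq G) y.seq_mem]

theorem lev_lt {x y : LevelTree G} (h : x < y) : x.lev < y.lev :=
  lt_of_not_ge fun h' => h.ne (eq_of_le_of_lev_le h.le h')

/-- The predecessor of a node on a given level. -/
noncomputable def restrict (x : LevelTree G) (a : OmegaOne.{u}) (h : a ≤ x.lev) : LevelTree G :=
  ⟨a, truncate a x.seq, truncate_mem (level_eq G) h x.seq_mem⟩

theorem restrict_le (x : LevelTree G) {a : OmegaOne.{u}} (h : a ≤ x.lev) : x.restrict a h ≤ x :=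
  ⟨h, rfl⟩

theorem eq_restrict {x y : LevelTree G} (h : x ≤ y) : x = y.restrict x.lev h.1 :=
  LevelTree.ext rfl h.2.symm

theorem restrict_le_restrict (x : LevelTree G) {a b : OmegaOne.{u}} (hab : a ≤ b)
    (h : b ≤ x.lev) : x.restrict a (hab.trans h) ≤ x.restrict b h :=
  ⟨hab, truncate_truncate hab _⟩

/-- The predecessors of a node are indexed by the smaller countable ordinals. -/
noncomputable def relIsoIio (x : LevelTree G) :
    (fun a b : Iio x => a < b) ≃r (fun a b : Iio x.lev => a < b) where
  toFun y := ⟨y.1.lev, lev_lt y.2⟩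
  invFun a := ⟨x.restrict a.1 (le_of_lt a.2), lt_of_le_of_ne (x.restrict_le (le_of_lt a.2))
    fun h => (ne_of_lt a.2) (congrArg lev h)⟩
  left_inv y := Subtype.ext (eq_restrict (le_of_lt y.2)).symm
  right_inv a := rfl
  map_rel_iff' {y z} := by
    refine ⟨fun h => ?_, fun h => lev_lt h⟩
    have hle : y.1 ≤ z.1 := by
      rw [eq_restrict (le_of_lt y.2), eq_restrict (le_of_lt z.2)]
      exact x.restrict_le_restrict (le_of_lt h) _
    exact lt_of_le_of_ne hle fun he =>
      (ne_of_lt h) (Subtype.ext (congrArg (fun w : Iio x => w.1.lev) he))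

instance : IsTreeOrder (LevelTree G) :=
  ⟨fun x => (relIsoIio x).toRelEmbedding.isWellOrder⟩

theorem nodeHeight_eq (x : LevelTree G) :
    nodeHeight x = Ordinal.typein (α := OmegaOne.{u}) (· < ·) x.lev :=
  (relIsoIio x).ordinalType_congr

theorem mem_treeLevel_iff {x : LevelTree G} {a : OmegaOne.{u}} :
    x ∈ treeLevel (LevelTree G) (Ordinal.typein (α := OmegaOne.{u}) (· < ·) a) ↔ x.lev = a := by
  rw [treeLevel, mem_ofPred_eq, nodeHeight_eq, Ordinal.typein_inj]

theorem exists_typein_eq {o : Ordinal.{u}} (ho : o < ω₁) :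
    ∃ a, Ordinal.typein (α := OmegaOne.{u}) (· < ·) a = o :=
  Ordinal.typein_surj _ (by rwa [Ordinal.type_toType])

variable (G)

theorem exists_lev_eq (a : OmegaOne.{u}) : ∃ x : LevelTree G, x.lev = a := by
  obtain ⟨t, ht⟩ := nonempty_level (level_eq G) a
  exact ⟨⟨a, t, ht⟩, rfl⟩

theorem countable_setOf_lev_eq (a : OmegaOne.{u}) : {x : LevelTree G | x.lev = a}.Countable := by
  refine MapsTo.countable_of_injOn (f := seq) (t := level G a) ?_ ?_
    (countable_and_hasExtensions (level_eq G) a).1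
  · rintro x rfl
    exact x.seq_mem
  · rintro x rfl y hy hxy
    exact LevelTree.ext hy.symm hxy

theorem treeHeight_eq : treeHeight (LevelTree G) = ω₁ := by
  refine le_antisymm (csInf_le' ?_) (le_csInf ⟨ω₁, ?_⟩ fun o ho => ?_)
  case refine_3 =>
    by_contra! hlt
    obtain ⟨a, rfl⟩ := exists_typein_eq hlt
    obtain ⟨x, hx⟩ := exists_lev_eq G a
    exact (ho ▸ mem_treeLevel_iff.2 hx : x ∈ (∅ : Set (LevelTree G)))
  all_goals
    refine eq_empty_of_forall_notMem fun x hx => ?_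
    exact (Ordinal.typein_lt_self x.lev).ne ((nodeHeight_eq x).symm.trans hx)

theorem isAlephOneTree : IsAlephOneTree (LevelTree G) := by
  refine ⟨treeHeight_eq G, fun o ho => ?_⟩
  obtain ⟨a, rfl⟩ := exists_typein_eq ho
  exact (countable_setOf_lev_eq G a).mono fun x hx => mem_treeLevel_iff.1 hx

/-- Last values strictly increase along the order, so nodes sharing a last value form an antichain,
one for each rational. -/
theorem isSpecialTree : IsSpecialTree (LevelTree G) := by
  obtain ⟨f, hf⟩ := exists_surjective_nat ℚ
  refine ⟨isAlephOneTree G, fun n => {x | x.seq x.lev = f n}, fun n x hx y hy hne hle => ?_,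
    eq_univ_of_forall fun x => ?_⟩
  · have hlt := lev_lt (lt_of_le_of_ne hle hne)
    have := (isNode_of_mem (level_eq G) y.seq_mem).strictMonoOn hlt.le self_mem_Iic hlt
    rw [← truncate_apply le_rfl y.seq, hle.2, show _ = _ from hx, show _ = _ from hy] at this
    exact this.ne rfl
  · obtain ⟨n, hn⟩ := hf (x.seq x.lev)
    exact mem_iUnion.2 ⟨n, hn.symm⟩

theorem isInfinitelySplitting : IsInfinitelySplitting (LevelTree G) := by
  intro x
  refine Infinite.of_image (fun y => y.seq (Order.succ x.lev)) ?_
  refine (Ioi_infinite (x.seq x.lev)).mono fun q hq => ?_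
  obtain ⟨t, ht, hts, htq⟩ := (countable_and_hasExtensions (level_eq G) (Order.succ x.lev)).2
    x.lev (Order.lt_succ _) x.seq x.seq_mem q hq
  have hle : x ≤ ⟨Order.succ x.lev, t, ht⟩ := ⟨Order.le_succ _, by
    rw [truncate_congr hts, truncate_self_of_mem (level_eq G) x.seq_mem]⟩
  refine ⟨⟨Order.succ x.lev, t, ht⟩, ⟨lt_of_le_of_ne hle fun h => ?_, fun z hxz hz => ?_⟩, htq⟩
  · exact (Order.lt_succ x.lev).ne (congrArg lev h)
  · exact (Order.covBy_succ x.lev).2 (lev_lt hxz) (lev_lt hz)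

variable {G}

theorem exists_forall_lev_lt {C : Set (LevelTree G)} (hC : C.Countable) :
    ∃ a, ∀ x ∈ C, x.lev < a := by
  obtain ⟨a, ha⟩ := OmegaOne.exists_forall_lt (hC.image lev)
  exact ⟨a, fun x hx => ha _ (mem_image_of_mem lev hx)⟩

variable (G)

/-- A chain meets each of the countably many antichains at most once, so it is countable and its
levels are bounded. -/
theorem isAronszajnTree : IsAronszajnTree (LevelTree G) := by
  refine ⟨isAlephOneTree G, ?_⟩
  rintro ⟨b, hb, hmeet⟩
  obtain ⟨-, A, hA, hAu⟩ := isSpecialTree G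
  have hcount : b.Countable := by
    rw [← inter_univ b, ← hAu, inter_iUnion]
    exact countable_iUnion fun n =>
      (inter_subsingleton_of_isChain_of_isAntichain hb.1 (hA n)).countable
  obtain ⟨a, ha⟩ := exists_forall_lev_lt hcount
  rw [treeHeight_eq] at hmeet
  obtain ⟨x, hxb, hx⟩ := hmeet _ (Ordinal.typein_lt_self a)
  exact (ha x hxb).ne (mem_treeLevel_iff.1 hx)

theorem not_isSuslinTree : ¬ IsSuslinTree (LevelTree G) := by
  intro h
  obtain ⟨-, A, hA, hAu⟩ := isSpecialTree G
  have hcount : (univ : Set (LevelTree G)).Countable :=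
    hAu ▸ countable_iUnion fun n => h.2.2 _ (hA n)
  obtain ⟨a, ha⟩ := exists_forall_lev_lt hcount
  obtain ⟨x, hx⟩ := exists_lev_eq G a
  exact (ha x (mem_univ x)).ne hx

variable {G}

theorem isLindelofTree (hG : ∀ R : OmegaOne.{u} × ℕ → Finset (OmegaOne.{u} × ℕ),
    ∃ a : OmegaOne.{u}, Order.IsSuccLimit a ∧ ∀ p : OmegaOne.{u} × ℕ, p.1 < a →
      G a p = R p ∧ ∀ q ∈ R p, q.1 < a) : IsLindelofTree (LevelTree G) := by
  classical
  refine ⟨isAlephOneTree G, lindelofSpace_fineWedge fun F hF => ?_⟩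
  let c : LevelTree G → OmegaOne.{u} × ℕ := fun x => (x.lev, code (level G x.lev) x.seq)
  have hc : Function.Injective c := by
    rintro ⟨a, s, hs⟩ ⟨b, t, ht⟩ h
    obtain ⟨rfl, h⟩ := Prod.ext_iff.1 h
    exact LevelTree.ext rfl (injOn_code (countable_and_hasExtensions (level_eq G) a).1 hs ht h)
  -- The guessed function is `F` transported along the coding `c`, with value `∅` at pairs coding no
  -- node.
  obtain ⟨a, ha, hG'⟩ := hG fun p => if h : ∃ x, c x = p then (F h.choose).image c else ∅
  have hGc : ∀ x, x.lev < a → G a (c x) = (F x).image c ∧ ∀ s ∈ F x, s.lev < a := by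
    intro x hx
    have hex : ∃ y, c y = c x := ⟨x, rfl⟩
    obtain ⟨h1, h2⟩ := hG' (c x) hx
    rw [dif_pos hex, hc hex.choose_spec] at h1 h2
    exact ⟨h1, fun s hs => h2 (c s) (Finset.mem_image_of_mem c hs)⟩
  refine ⟨⋃ b ∈ Iic a, {x | x.lev = b}, (OmegaOne.countable_Iic a).biUnion
    fun b _ => countable_setOf_lev_eq G b, fun y => ?_⟩
  by_cases hya : y.lev ≤ a
  · exact ⟨y, mem_iUnion₂.2 ⟨y.lev, hya, rfl⟩, le_rfl, hF y⟩
  · replace hya := le_of_not_ge hya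
    obtain ⟨b, hb, havoid⟩ :=
      (isNode_of_mem (level_eq G) (y.restrict a hya).seq_mem).exists_avoid ha
    have hby : b ≤ y.lev := hb.le.trans hya
    refine ⟨y.restrict b hby, mem_iUnion₂.2 ⟨b, hb.le, rfl⟩, y.restrict_le hby, fun s hs hsy => ?_⟩
    obtain ⟨hG1, hG2⟩ := hGc (y.restrict b hby) hb
    have hsa := hG2 s hs
    -- If `s` had level at most `b`, then `s ≤ y` would place it below `y.restrict b hby`, contrary
    -- to `hF`. So `s` is a restriction of `y` strictly between `b` and `a`, where avoidance
    -- applies.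
    have hbs : b < s.lev := lt_of_not_ge fun h => hF _ s hs <| by
      rw [eq_restrict hsy]
      exact y.restrict_le_restrict h hby
    refine havoid s.lev hbs hsa ?_
    have h1 : truncate s.lev (y.restrict a hya).seq = s.seq :=
      (truncate_truncate hsa.le y.seq).trans hsy.2
    have h2 : truncate b (y.restrict a hya).seq = (y.restrict b hby).seq :=
      truncate_truncate hb.le y.seq
    rw [h1, h2]
    exact hG1.symm ▸ Finset.mem_image_of_mem c hs

end LevelTree

end LevelTree

theorem mainTheorem5 (hdiamond : Diamond.{u}) :
    -- there is a special Aronszajn tree that is Lindelöf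
    (∃ (T : Type u) (_ : PartialOrder T) (_ : IsTreeOrder T),
      IsAronszajnTree T ∧ IsSpecialTree T ∧ IsLindelofTree T) ∧
    -- there is a Lindelöf tree that is not Suslin
    (∃ (T : Type u) (_ : PartialOrder T) (_ : IsTreeOrder T),
      IsLindelofTree T ∧ ¬ IsSuslinTree T) ∧
    -- among infinitely splitting trees, the Suslin trees are a proper subclass of the Lindelöf ones
    ((∀ (T : Type u) [PartialOrder T] [IsTreeOrder T],
        IsInfinitelySplitting T → IsSuslinTree T → IsLindelofTree T) ∧
      ∃ (T : Type u) (_ : PartialOrder T) (_ : IsTreeOrder T),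
        IsInfinitelySplitting T ∧ IsLindelofTree T ∧ ¬ IsSuslinTree T) := by
  obtain ⟨G, hG⟩ := hdiamond.exists_guess
  have hL : IsLindelofTree (LevelTree G) := LevelTree.isLindelofTree hG
  exact ⟨⟨LevelTree G, _, inferInstance, LevelTree.isAronszajnTree G, LevelTree.isSpecialTree G, hL⟩,
    ⟨LevelTree G, _, inferInstance, hL, LevelTree.not_isSuslinTree G⟩,
    fun T _ _ hT hS => hS.isLindelofTree hT,
    ⟨LevelTree G, _, inferInstance, LevelTree.isInfinitelySplitting G, hL,
      LevelTree.not_isSuslinTree G⟩⟩
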